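/- Let $0<t<T$, $\sigma>0$, $S_0\in\mathbb R$, let $v$ be a fixed trading rate and $G$ a fixed decay kernel, integrable on $[0,T]$. Let $\Gamma\subseteq\mathbb R$ be a parameter set and $f(v;\cdot):\Gamma\to\mathbb R$ an impact function. Suppose that for each $\eta\in\Gamma$, under the probability measure $\mathbb P_\eta$, the price follows the propagator model $$S_r=S_0+\int_0^r f(v;\eta)\,G(r-s)\,ds+\sigma W_r,\qquad 0\le r\le T,$$ with $W$ a standard Brownian motion under $\mathbb P_\eta$. Let $\theta\in\Gamma$ be an accumulation point of $\Gamma$ at which $f(v;\cdot)$ is differentiable (relative to $\Gamma$). For a statistic $X$ with likelihood $p_\eta$ (the Lebesgue density of its law under $\mathbb P_\eta$), write $\mathcal I_X(\theta)=\mathbb E_\theta\big[\big(\tfrac{\partial}{\partial\theta}\log p_\theta(X)\big)^2\big]$ for its Fisher information, and let $J=\int_0^T S_r\,dr$. Then $\mathcal I_{S_t,S_T}(\theta)$ and $\mathcal I_J(\theta)$ exist, and $$\mathcal I_{S_t,S_T}(\theta)=\frac{\big(\frac{\partial f}{\partial\theta}(v;\theta)\big)^2}{\sigma^2}\left(\frac{\big(\int_0^tG(s)\,ds\big)^2}{t}+\frac{\big(\int_t^TG(s)\,ds\big)^2}{T-t}\right).$$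 Consequently $\mathcal I_{S_t,S_T}(\theta)\ge\mathcal I_J(\theta)$ whenever $$\frac{\big(\int_0^tG(s)\,ds\big)^2}{t}+\frac{\big(\int_t^TG(s)\,ds\big)^2}{T-t}\ \ge\ \frac{3}{T^3}\Big(\int_0^TG(s)(T-s)\,ds\Big)^2,$$ and if $\frac{\partial f}{\partial\theta}(v;\theta)\ne0$, the converse holds as well. -/

import Mathlib

open MeasureTheory ProbabilityTheory
open scoped NNReal

/-- `p η` is a density, with respect to Lebesgue measure, of the law of the statistic `X`
under `P η`, for every parameter `η ∈ Γ`. -/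
structure IsLikelihood {Ω E : Type*} [MeasurableSpace Ω] [MeasureSpace E]
    (Γ : Set ℝ) (P : ℝ → Measure Ω) (X : Ω → E) (p : ℝ → E → ℝ) : Prop where
  measurable : ∀ η ∈ Γ, Measurable (p η)
  nonneg : ∀ η ∈ Γ, ∀ x, 0 ≤ p η x
  hasLaw : ∀ η ∈ Γ,
    HasLaw X ((volume : Measure E).withDensity fun x => ENNReal.ofReal (p η x)) (P η)

/-- The score `∂ log p_θ(x) / ∂θ` (derivative relative to the parameter set `Γ`). -/
noncomputable def score {E : Type*} (Γ : Set ℝ) (p : ℝ → E → ℝ) (θ : ℝ) (x : E) : ℝ :=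
  derivWithin (fun η => Real.log (p η x)) Γ θ

/-- The experiment of observing the statistic `X` under `(P η)_{η ∈ Γ}` has a likelihood that is
almost surely differentiable in the parameter at `θ`, the score is square integrable under `P θ`,
and its second moment is `I`. -/
def HasFisherInfo {Ω E : Type*} [MeasurableSpace Ω] [MeasureSpace E]
    (Γ : Set ℝ) (P : ℝ → Measure Ω) (X : Ω → E) (θ : ℝ) (I : ℝ) : Prop :=
  ∃ p : ℝ → E → ℝ, IsLikelihood Γ P X p ∧
    (∀ᵐ ω ∂(P θ), DifferentiableWithinAt ℝ (fun η => p η (X ω)) Γ θ) ∧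
    Integrable (fun ω => score Γ p θ (X ω) ^ 2) (P θ) ∧
    ∫ ω, score Γ p θ (X ω) ^ 2 ∂(P θ) = I

open Classical in
/-- The Fisher information `E_θ[(∂ log p_θ(X) / ∂θ)²]` of the statistic `X` at `θ`
(`0` if it does not exist). By `HasFisherInfo.unique` it does not depend on the version of the
likelihood. -/
noncomputable def fisherInfo {Ω E : Type*} [MeasurableSpace Ω] [MeasureSpace E]
    (Γ : Set ℝ) (P : ℝ → Measure Ω) (X : Ω → E) (θ : ℝ) : ℝ :=
  if h : ∃ I, HasFisherInfo Γ P X θ I then h.choose else 0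

theorem HasFisherInfo.unique {Ω E : Type*} [MeasurableSpace Ω] [MeasureSpace E]
    [SigmaFinite (volume : Measure E)]
    {Γ : Set ℝ} {P : ℝ → Measure Ω} {X : Ω → E} {θ I I' : ℝ}
    (hθ : θ ∈ Γ) (hacc : AccPt θ (Filter.principal Γ))
    (h : HasFisherInfo Γ P X θ I) (h' : HasFisherInfo Γ P X θ I') : I = I' := by
  obtain ⟨p, hp, hpd, -, rfl⟩ := h
  obtain ⟨q, hq, hqd, -, rfl⟩ := h'
  have key : ∀ η ∈ Γ, ∀ᵐ ω ∂(P θ), p η (X ω) = q η (X ω) := by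
    intro η hη
    have e := (hp.hasLaw η hη).map_eq.symm.trans (hq.hasLaw η hη).map_eq
    have e2 := (withDensity_eq_iff_of_sigmaFinite
      ((hp.measurable η hη).ennreal_ofReal.aemeasurable)
      ((hq.measurable η hη).ennreal_ofReal.aemeasurable)).1 e
    have e3 : ∀ᵐ x ∂(volume : Measure E), p η x = q η x := by
      filter_upwards [e2] with x hx
      exact (ENNReal.ofReal_eq_ofReal_iff (hp.nonneg η hη x) (hq.nonneg η hη x)).1 hx
    have e4 : ∀ᵐ x ∂((P θ).map X), p η x = q η x := by
      rw [(hp.hasLaw θ hθ).map_eq]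
      exact (withDensity_absolutelyContinuous _ _).ae_le e3
    exact ae_of_ae_map (hp.hasLaw θ hθ).aemeasurable e4
  have hpos : ∀ᵐ ω ∂(P θ), p θ (X ω) ≠ 0 := by
    have e4 : ∀ᵐ x ∂((P θ).map X), p θ x ≠ 0 := by
      rw [(hp.hasLaw θ hθ).map_eq,
        ae_withDensity_iff (hp.measurable θ hθ).ennreal_ofReal]
      filter_upwards with x hx h0
      simp [h0] at hx
    exact ae_of_ae_map (hp.hasLaw θ hθ).aemeasurable e4
  have hu : UniqueDiffWithinAt ℝ Γ θ := uniqueDiffWithinAt_iff_accPt.2 hacc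
  rw [accPt_principal_iff_nhdsWithin] at hacc
  obtain ⟨u, hu1, hu2⟩ := mem_closure_iff_seq_limit.1
    (mem_closure_iff_nhdsWithin_neBot.2 hacc)
  have hut : Filter.Tendsto u Filter.atTop (nhdsWithin θ (Γ \ {θ})) :=
    tendsto_nhdsWithin_iff.2 ⟨hu2, Filter.Eventually.of_forall hu1⟩
  have hall : ∀ᵐ ω ∂(P θ), ∀ n, p (u n) (X ω) = q (u n) (X ω) :=
    ae_all_iff.2 fun n => key _ (hu1 n).1
  apply integral_congr_ae
  filter_upwards [hpd, hqd, hpos, key θ hθ, hall] with ω d1 d2 h0 e1 e2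
  have l1 := (d1.log h0).hasDerivWithinAt
  have l2 := (d2.log (e1 ▸ h0)).hasDerivWithinAt
  have t1 := (hasDerivWithinAt_iff_tendsto_slope.1 l1).comp hut
  have t2 := (hasDerivWithinAt_iff_tendsto_slope.1 l2).comp hut
  have : score Γ p θ (X ω) = score Γ q θ (X ω) := by
    refine tendsto_nhds_unique t1 (t2.congr fun n => ?_)
    simp [slope_def_field, e1, e2 n]
  simp only [this]

theorem HasFisherInfo.fisherInfo_eq {Ω E : Type*} [MeasurableSpace Ω] [MeasureSpace E]
    [SigmaFinite (volume : Measure E)]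
    {Γ : Set ℝ} {P : ℝ → Measure Ω} {X : Ω → E} {θ I : ℝ}
    (hθ : θ ∈ Γ) (hacc : AccPt θ (Filter.principal Γ))
    (h : HasFisherInfo Γ P X θ I) : fisherInfo Γ P X θ = I := by
  have h1 : ∃ I, HasFisherInfo Γ P X θ I := ⟨I, h⟩
  rw [fisherInfo, dif_pos h1]
  exact HasFisherInfo.unique hθ hacc h1.choose_spec h

/-- Under `P`, the process `S` follows, on `[0, T]`, the propagator dynamics
`S_t = S₀ + ∫₀ᵗ c G(t - s) ds + σ W_t` for a standard Brownian motion `W`, where `c` is the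
instantaneous impact of the constant trading rate. -/
def IsPropagatorPrice {Ω : Type*} [MeasurableSpace Ω] (P : Measure Ω)
    (S₀ c σ T : ℝ) (G : ℝ → ℝ) (S : ℝ → Ω → ℝ) : Prop :=
  ∃ W : ℝ≥0 → Ω → ℝ, IsBrownianReal W P ∧
    ∀ᵐ ω ∂P, ∀ t : ℝ≥0, (t : ℝ) ≤ T →
      S t ω = S₀ + (∫ s in (0 : ℝ)..t, c * G (t - s)) + σ * W t ω

/-- The pair of prices `(S_t, S_T)`. -/
def twoPrices {Ω : Type*} (S : ℝ → Ω → ℝ) (t T : ℝ) (ω : Ω) : ℝ × ℝ := (S t ω, S T ω)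

/-- The VWAP cost `J = ∫₀ᵀ S_r dr`. -/
noncomputable def vwapCost {Ω : Type*} (S : ℝ → Ω → ℝ) (T : ℝ) (ω : Ω) : ℝ :=
  ∫ r in (0 : ℝ)..T, S r ω

/-- The factor `(∫₀ᵗ G)² / t + (∫ₜᵀ G)² / (T - t)`. -/
noncomputable def twoPriceFactor (G : ℝ → ℝ) (t T : ℝ) : ℝ :=
  (∫ s in (0 : ℝ)..t, G s) ^ 2 / t + (∫ s in t..T, G s) ^ 2 / (T - t)

/-! At a fixed trading rate the impact is a scalar `c = f v η`, so the drift of the price is `c`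
times the primitive of `G`. The parameter therefore only shifts means: `S t`, `S T - S t` and the
cost are Gaussian with variances `σ² t`, `σ² (T - t)` and `σ² T³ / 3`, free of `η`, and with means
affine in `c`. A Gaussian location family with mean `m` and variance `v` has information `m'² / v`
(`hasFisherInfo_gaussianReal`). The pair is a unimodular shear of two independent Gaussians, so
their informations add (`hasFisherInfo_prodMk_of_indepFun_sub`). The cost needs the law of the
integral of Brownian motion (`hasLaw_intervalIntegral`), obtained as a limit of Gaussian Riemann
sums. Both informations are `f'² / σ²` times a kernel factor, which gives the comparison.
`HasFisherInfo.fisherInfo_eq` allows computing with the explicit Gaussian densities. -/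

/-! ### Law of the time integral of Brownian motion -/

/-- Left Riemann sums over uniform subdivisions of `[0, T]` converge to the integral. -/
theorem tendsto_riemannSum_intervalIntegral {f : ℝ → ℝ} (hf : Continuous f) {T : ℝ} (hT : 0 < T) :
    Filter.Tendsto (fun n : ℕ => T / n * ∑ k ∈ Finset.range n, f (k * (T / n)))
      Filter.atTop (nhds (∫ x in (0 : ℝ)..T, f x)) := by
  have huc := isCompact_Icc.uniformContinuousOn_of_continuous (hf.continuousOn (s := Set.Icc 0 T))
  rw [Metric.uniformContinuousOn_iff] at huc
  rw [Metric.tendsto_atTop]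
  intro ε hε
  -- This oscillation bound sums to `ε / 2` over `[0, T]`; the spare half restores strictness.
  obtain ⟨δ, hδ, h⟩ := huc (ε / (2 * T)) (by positivity)
  obtain ⟨N, hN⟩ := exists_nat_gt (T / δ)
  refine ⟨N + 1, fun n hn => ?_⟩
  have hn0 : (0 : ℝ) < n := by exact_mod_cast (by omega : 0 < n)
  have hNn : (N : ℝ) < n := by exact_mod_cast (by omega : N < n)
  set d : ℝ := T / n with hd
  have hd0 : 0 < d := by positivity
  have hnd : n * d = T := by rw [hd]; field_simp
  have hdδ : d < δ := by
    rw [hd, div_lt_iff₀ hn0]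
    rw [div_lt_iff₀ hδ] at hN
    nlinarith
  have hsum : ∫ x in (0 : ℝ)..T, f x
      = ∑ k ∈ Finset.range n, ∫ x in (k * d : ℝ)..((k + 1 : ℕ) * d : ℝ), f x := by
    rw [intervalIntegral.sum_integral_adjacent_intervals (a := fun k : ℕ => (k * d : ℝ))
      (fun k _ => hf.intervalIntegrable _ _)]
    simp [hnd]
  rw [Real.dist_eq, hsum, Finset.mul_sum, ← Finset.sum_sub_distrib]
  have hterm : ∀ k ∈ Finset.range n,
      |d * f (k * d) - ∫ x in (k * d : ℝ)..((k + 1 : ℕ) * d : ℝ), f x| ≤ ε / (2 * T) * d := by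
    intro k hk
    have hk1 : (k : ℝ) + 1 ≤ n := by exact_mod_cast Finset.mem_range.1 hk
    have hlen : ((k + 1 : ℕ) * d : ℝ) - k * d = d := by push_cast; ring
    have e : d * f (k * d) - ∫ x in (k * d : ℝ)..((k + 1 : ℕ) * d : ℝ), f x
        = ∫ x in (k * d : ℝ)..((k + 1 : ℕ) * d : ℝ), (f (k * d) - f x) := by
      rw [intervalIntegral.integral_sub (by simp) (hf.intervalIntegrable _ _),
        intervalIntegral.integral_const, hlen, smul_eq_mul]
    rw [e, ← Real.norm_eq_abs]
    have := intervalIntegral.norm_integral_le_of_norm_le_const (a := (k * d : ℝ))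
      (b := ((k + 1 : ℕ) * d : ℝ)) (C := ε / (2 * T)) (f := fun x => f (k * d) - f x) ?_
    · rwa [hlen, abs_of_pos hd0] at this
    intro x hx
    rw [Set.uIoc_of_le (by linarith)] at hx
    have hkd : 0 ≤ (k : ℝ) * d := by positivity
    have hle : ((k : ℝ) + 1) * d ≤ T := by rw [← hnd]; gcongr
    have hx2 : x ≤ ((k : ℝ) + 1) * d := by simpa using hx.2
    refine (h (k * d) ⟨hkd, by linarith⟩ x ⟨by linarith [hx.1], by linarith⟩ ?_).le
    rw [Real.dist_eq, abs_lt]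
    constructor <;> linarith [hx.1]
  calc _ ≤ ∑ k ∈ Finset.range n, ε / (2 * T) * d :=
        (Finset.abs_sum_le_sum_abs _ _).trans (Finset.sum_le_sum hterm)
    _ = ε / 2 := by
        rw [Finset.sum_const, Finset.card_range, nsmul_eq_mul]
        calc (n : ℝ) * (ε / (2 * T) * d) = ε / (2 * T) * (n * d) := by ring
          _ = ε / 2 := by rw [hnd]; field_simp
    _ < ε := by linarith

/-- An almost sure limit of centred Gaussian variables whose variances converge is Gaussian. -/
theorem hasLaw_gaussianReal_of_tendsto_ae {Ω : Type*} [MeasurableSpace Ω] {P : Measure Ω}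
    {X : ℕ → Ω → ℝ} {Z : Ω → ℝ} {v : ℕ → ℝ≥0} {w : ℝ≥0}
    (hX : ∀ n, HasLaw (X n) (gaussianReal 0 (v n)) P)
    (hXZ : ∀ᵐ ω ∂P, Filter.Tendsto (fun n => X n ω) Filter.atTop (nhds (Z ω)))
    (hv : Filter.Tendsto v Filter.atTop (nhds w)) :
    HasLaw Z (gaussianReal 0 w) P := by
  have hP : IsProbabilityMeasure P := (hX 0).isProbabilityMeasure
  have hZ : AEMeasurable Z P :=
    aemeasurable_of_tendsto_metrizable_ae _ (fun n => (hX n).aemeasurable) hXZ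
  refine ⟨hZ, ?_⟩
  have := Measure.isProbabilityMeasure_map hZ
  apply Measure.ext_of_charFun
  ext u
  have hmeas : Continuous fun x : ℝ => Complex.exp (u * x * Complex.I) := by fun_prop
  have hcf : ∀ n, ∫ ω, Complex.exp (u * X n ω * Complex.I) ∂P
      = Complex.exp (u * (0 : ℝ) * Complex.I - (v n) * u ^ 2 / 2) := by
    intro n
    rw [← charFun_gaussianReal, ← (hX n).map_eq, charFun_apply_real,
      integral_map (hX n).aemeasurable hmeas.aestronglyMeasurable]
  -- Characteristic functions converge by dominated convergence, the integrands having modulus one.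
  have hlim : Filter.Tendsto (fun n => ∫ ω, Complex.exp (u * X n ω * Complex.I) ∂P)
      Filter.atTop (nhds (∫ ω, Complex.exp (u * Z ω * Complex.I) ∂P)) := by
    refine tendsto_integral_of_dominated_convergence (fun _ => 1)
      (fun n => (hmeas.measurable.comp_aemeasurable (hX n).aemeasurable).aestronglyMeasurable)
      (integrable_const _) (fun n => ?_) ?_
    · refine Filter.Eventually.of_forall fun ω => ?_
      rw [← Complex.ofReal_mul, Complex.norm_exp_ofReal_mul_I]
    · filter_upwards [hXZ] with ω hω
      exact (hmeas.tendsto (Z ω)).comp hω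
  have hlim2 : Filter.Tendsto
      (fun n => Complex.exp (u * (0 : ℝ) * Complex.I - ((v n : ℝ) : ℂ) * u ^ 2 / 2))
      Filter.atTop (nhds (Complex.exp (u * (0 : ℝ) * Complex.I - ((w : ℝ) : ℂ) * u ^ 2 / 2))) := by
    have hc : Continuous fun x : ℝ≥0 =>
      Complex.exp (u * (0 : ℝ) * Complex.I - ((x : ℝ) : ℂ) * u ^ 2 / 2) := by fun_prop
    exact (hc.tendsto w).comp hv
  rw [charFun_gaussianReal, charFun_apply_real, integral_map hZ hmeas.aestronglyMeasurable]
  exact tendsto_nhds_unique hlim (hlim2.congr fun n => (hcf n).symm)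

/-- Brownian covariance is `min`, so this double sum is the variance of a left Riemann sum up to
scaling. Each induction step adds a row, a column and a diagonal entry. -/
theorem sum_sum_min_range (n : ℕ) :
    ∑ i ∈ Finset.range n, ∑ j ∈ Finset.range n, (min i j : ℝ) = (n - 1) * n * (2 * n - 1) / 6 := by
  induction n with
  | zero => simp
  | succ n ih =>
    have h1 : ∀ m : ℕ, ∑ i ∈ Finset.range m, (i : ℝ) = m * (m - 1) / 2 := by
      intro m
      induction m with
      | zero => simp
      | succ m ih => rw [Finset.sum_range_succ, ih]; push_cast; ring
    have h2 : ∑ i ∈ Finset.range n, (min i n : ℝ) = n * (n - 1) / 2 := by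
      rw [← h1]
      exact Finset.sum_congr rfl fun i hi =>
        min_eq_left (by exact_mod_cast (Finset.mem_range.1 hi).le)
    have h3 : ∑ i ∈ Finset.range n, (min n i : ℝ) = n * (n - 1) / 2 := by
      rw [← h2]
      exact Finset.sum_congr rfl fun i _ => min_comm _ _
    simp only [Finset.sum_range_succ, Finset.sum_add_distrib]
    rw [ih, h2, h3, min_self]
    push_cast
    ring

/-- The time integral of a Brownian motion over `[0, T]` has law `N(0, T³ / 3)`. -/
theorem ProbabilityTheory.IsBrownianReal.hasLaw_intervalIntegral {Ω : Type*} [MeasurableSpace Ω]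
    {P : Measure Ω} {W : ℝ≥0 → Ω → ℝ} (hW : IsBrownianReal W P) {T : ℝ} (hT : 0 < T) :
    HasLaw (fun ω => ∫ r in (0 : ℝ)..T, W r.toNNReal ω)
      (gaussianReal 0 (T ^ 3 / 3).toNNReal) P := by
  have hP : IsProbabilityMeasure P := hW.isGaussianProcess.isProbabilityMeasure
  set τ : ℕ → ℕ → ℝ≥0 := fun n k => (k * (T / n)).toNNReal with hτ
  set X : ℕ → Ω → ℝ := fun n ω => T / n * ∑ k ∈ Finset.range n, W (τ n k) ω with hXdef
  have hL2 : ∀ r, MemLp (W r) 2 P := fun r => (hW.isGaussianProcess.hasGaussianLaw_eval r).memLp_two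
  have hG : ∀ n, HasGaussianLaw (X n) P := fun n =>
    ((hW.isGaussianProcess.comp_right (τ n)).hasGaussianLaw_fun_sum
      (I := Finset.range n)).fun_smul (T / n)
  have hmean : ∀ n, ∫ ω, X n ω ∂P = 0 := by
    intro n
    simp only [hXdef]
    rw [integral_const_mul, integral_finsetSum _ fun k _ => hW.integrable_eval _]
    simp [hW.integral_eval]
  have hvar : ∀ n : ℕ, Var[X n; P] = (T / n) ^ 3 * ((n - 1) * n * (2 * n - 1) / 6) := by
    intro n
    rw [← covariance_self (hG n).aemeasurable]
    simp only [hXdef]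
    rw [covariance_const_mul_left, covariance_const_mul_right,
      covariance_fun_sum_fun_sum' (fun i _ => hL2 _) (fun i _ => hL2 _), ← sum_sum_min_range]
    have : ∀ i j : ℕ, cov[W (τ n i), W (τ n j); P] = T / n * min (i : ℝ) j := by
      intro i j
      have hTn : 0 ≤ T / n := by positivity
      rw [hW.covariance_eval, hτ]
      simp only [NNReal.coe_min]
      rw [Real.coe_toNNReal _ (by positivity), Real.coe_toNNReal _ (by positivity),
        ← min_mul_of_nonneg _ _ hTn, mul_comm]
    simp only [this, ← Finset.mul_sum]
    ring
  have hX : ∀ n, HasLaw (X n) (gaussianReal 0 (Var[X n; P]).toNNReal) P := fun n =>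
    ⟨(hG n).aemeasurable, by rw [(hG n).map_eq_gaussianReal, hmean]⟩
  refine hasLaw_gaussianReal_of_tendsto_ae hX ?_ ?_
  · filter_upwards [hW.cont] with ω hω
    exact tendsto_riemannSum_intervalIntegral (f := fun r => W r.toNNReal ω)
      (hω.comp continuous_real_toNNReal) hT
  · refine (continuous_real_toNNReal.tendsto _).comp ?_
    have h0 : Filter.Tendsto (fun n : ℕ => ((n : ℝ))⁻¹) Filter.atTop (nhds 0) :=
      tendsto_inv_atTop_nhds_zero_nat
    have h1 : Filter.Tendsto (fun n : ℕ => T ^ 3 * ((1 - (n : ℝ)⁻¹) * (2 - (n : ℝ)⁻¹) / 6))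
        Filter.atTop (nhds (T ^ 3 * ((1 - 0) * (2 - 0) / 6))) :=
      ((((tendsto_const_nhds.sub h0).mul (tendsto_const_nhds.sub h0)).div_const _).const_mul _)
    have e : T ^ 3 * ((1 - 0) * (2 - 0) / 6) = T ^ 3 / 3 := by ring
    rw [e] at h1
    refine h1.congr' ?_
    -- At `n = 0` the two expressions differ, since division by zero gives zero.
    filter_upwards [Filter.eventually_gt_atTop 0] with n hn
    have : (n : ℝ) ≠ 0 := by exact_mod_cast hn.ne'
    rw [hvar]
    field_simp

/-! ### Scores and information of Gaussian families -/

theorem hasDerivWithinAt_log_gaussianPDFReal {m : ℝ → ℝ} {m' θ x : ℝ} {v : ℝ≥0} {Γ : Set ℝ}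
    (hv : v ≠ 0) (hm : HasDerivWithinAt m m' Γ θ) :
    HasDerivWithinAt (fun η => Real.log (gaussianPDFReal (m η) v x)) (m' / v * (x - m θ)) Γ θ := by
  have hv0 : (0 : ℝ) < v := by positivity
  have e : (fun η => Real.log (gaussianPDFReal (m η) v x))
      = fun η => Real.log (√(2 * Real.pi * v))⁻¹ + -(x - m η) ^ 2 / (2 * v) := by
    funext η
    rw [gaussianPDFReal, Real.log_mul (by positivity) (Real.exp_pos _).ne', Real.log_exp]
  rw [e]
  refine ((((hm.const_sub x).pow 2).neg.div_const (2 * (v : ℝ))).const_add _).congr_deriv ?_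
  field_simp
  norm_num
  ring

theorem differentiableWithinAt_gaussianPDFReal {m : ℝ → ℝ} {θ x : ℝ} {v : ℝ≥0} {Γ : Set ℝ}
    (hm : DifferentiableWithinAt ℝ m Γ θ) :
    DifferentiableWithinAt ℝ (fun η => gaussianPDFReal (m η) v x) Γ θ := by
  simp only [gaussianPDFReal]
  fun_prop

theorem ProbabilityTheory.HasLaw.variance_gaussianReal {Ω : Type*} [MeasurableSpace Ω]
    {P : Measure Ω} {X : Ω → ℝ} {μ : ℝ} {v : ℝ≥0} (hX : HasLaw X (gaussianReal μ v) P) :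
    Var[X; P] = v := by
  rw [hX.variance_eq, variance_id_gaussianReal]

theorem ProbabilityTheory.HasLaw.integral_gaussianReal {Ω : Type*} [MeasurableSpace Ω]
    {P : Measure Ω} {X : Ω → ℝ} {μ : ℝ} {v : ℝ≥0} (hX : HasLaw X (gaussianReal μ v) P) :
    ∫ ω, X ω ∂P = μ := by
  rw [hX.integral_eq, integral_id_gaussianReal]

/-- Fisher information of a Gaussian location family with fixed variance. -/
theorem hasFisherInfo_gaussianReal {Ω : Type*} [MeasurableSpace Ω] {Γ : Set ℝ} {P : ℝ → Measure Ω}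
    {X : Ω → ℝ} {m : ℝ → ℝ} {m' θ : ℝ} {v : ℝ≥0} (hv : v ≠ 0)
    (hX : ∀ η ∈ Γ, HasLaw X (gaussianReal (m η) v) (P η))
    (hθ : θ ∈ Γ) (hacc : AccPt θ (Filter.principal Γ)) (hm : HasDerivWithinAt m m' Γ θ) :
    HasFisherInfo Γ P X θ (m' ^ 2 / v) := by
  have hv0 : (0 : ℝ) < v := by positivity
  have hlaw : HasLaw (fun ω => X ω - m θ) (gaussianReal 0 v) (P θ) := by
    simpa using gaussianReal_sub_const (hX θ hθ) (m θ)
  have hscore : ∀ x, score Γ (fun η => gaussianPDFReal (m η) v) θ x = m' / v * (x - m θ) :=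
    fun x => (hasDerivWithinAt_log_gaussianPDFReal hv hm).derivWithin
      (uniqueDiffWithinAt_iff_accPt.2 hacc)
  have hL2 : MemLp (fun ω => X ω - m θ) 2 (P θ) := hlaw.hasGaussianLaw.memLp_two
  refine ⟨fun η => gaussianPDFReal (m η) v, ⟨fun η _ => measurable_gaussianPDFReal _ _,
    fun η _ => gaussianPDFReal_nonneg _ _, fun η hη => ?_⟩, ?_, ?_, ?_⟩
  · have := hX η hη
    rwa [gaussianReal_of_var_ne_zero _ hv] at this
  · exact Filter.Eventually.of_forall fun ω =>
      differentiableWithinAt_gaussianPDFReal hm.differentiableWithinAt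
  · simp only [hscore]
    exact (hL2.const_mul _).integrable_sq
  · simp only [hscore, mul_pow]
    rw [integral_const_mul, ← variance_of_integral_eq_zero hlaw.aemeasurable
      hlaw.integral_gaussianReal, hlaw.variance_gaussianReal]
    field_simp

/-- Fisher information of a pair with independent Gaussian increments of fixed variances. -/
theorem hasFisherInfo_prodMk_of_indepFun_sub {Ω : Type*} [MeasurableSpace Ω] {Γ : Set ℝ}
    {P : ℝ → Measure Ω} {X Y : Ω → ℝ} {m n : ℝ → ℝ} {m' n' θ : ℝ} {v w : ℝ≥0}
    (hv : v ≠ 0) (hw : w ≠ 0)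
    (hX : ∀ η ∈ Γ, HasLaw X (gaussianReal (m η) v) (P η))
    (hY : ∀ η ∈ Γ, HasLaw (fun ω => Y ω - X ω) (gaussianReal (n η) w) (P η))
    (hXY : ∀ η ∈ Γ, IndepFun X (fun ω => Y ω - X ω) (P η))
    (hθ : θ ∈ Γ) (hacc : AccPt θ (Filter.principal Γ))
    (hm : HasDerivWithinAt m m' Γ θ) (hn : HasDerivWithinAt n n' Γ θ) :
    HasFisherInfo Γ P (fun ω => (X ω, Y ω)) θ (m' ^ 2 / v + n' ^ 2 / w) := by
  have hv0 : (0 : ℝ) < v := by positivity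
  have hw0 : (0 : ℝ) < w := by positivity
  have hlawX : HasLaw (fun ω => X ω - m θ) (gaussianReal 0 v) (P θ) := by
    simpa using gaussianReal_sub_const (hX θ hθ) (m θ)
  have hlawY : HasLaw (fun ω => Y ω - X ω - n θ) (gaussianReal 0 w) (P θ) := by
    simpa using gaussianReal_sub_const (hY θ hθ) (n θ)
  set p : ℝ → ℝ × ℝ → ℝ :=
    fun η z => gaussianPDFReal (m η) v z.1 * gaussianPDFReal (n η) w (z.2 - z.1) with hp
  have hpmeas : ∀ η, Measurable (p η) := fun η =>
    ((measurable_gaussianPDFReal _ _).comp measurable_fst).mul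
      ((measurable_gaussianPDFReal _ _).comp (measurable_snd.sub measurable_fst))
  have hscore : ∀ z, score Γ p θ z = m' / v * (z.1 - m θ) + n' / w * (z.2 - z.1 - n θ) := by
    intro z
    have e : (fun η => Real.log (p η z)) = fun η => Real.log (gaussianPDFReal (m η) v z.1)
        + Real.log (gaussianPDFReal (n η) w (z.2 - z.1)) := by
      funext η
      exact Real.log_mul (gaussianPDFReal_pos _ _ _ hv).ne' (gaussianPDFReal_pos _ _ _ hw).ne'
    rw [score, e]
    exact ((hasDerivWithinAt_log_gaussianPDFReal hv hm).add
      (hasDerivWithinAt_log_gaussianPDFReal hw hn)).derivWithin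
        (uniqueDiffWithinAt_iff_accPt.2 hacc)
  have hLX : MemLp (fun ω => m' / v * (X ω - m θ)) 2 (P θ) :=
    hlawX.hasGaussianLaw.memLp_two.const_mul _
  have hLY : MemLp (fun ω => n' / w * (Y ω - X ω - n θ)) 2 (P θ) :=
    hlawY.hasGaussianLaw.memLp_two.const_mul _
  have hP : IsProbabilityMeasure (P θ) := hlawX.isProbabilityMeasure
  refine ⟨p, ⟨fun η _ => hpmeas η,
    fun η _ z => mul_nonneg (gaussianPDFReal_nonneg _ _ _) (gaussianPDFReal_nonneg _ _ _),
    fun η hη => ?_⟩, ?_, ?_, ?_⟩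
  · have hPη : IsProbabilityMeasure (P η) := (hX η hη).isProbabilityMeasure
    -- The shear `(x, y) ↦ (x, x + y)` preserves Lebesgue measure, so the product density of `(X, Y
    -- - X)` transports to `p η` with no Jacobian factor.
    have hshear := measurePreserving_prod_add (volume : Measure ℝ) (volume : Measure ℝ)
    have hprod : (P η).map (fun ω => (X ω, Y ω - X ω))
        = (volume : Measure (ℝ × ℝ)).withDensity
            fun z => ENNReal.ofReal (p η (z.1, z.1 + z.2)) := by
      rw [(indepFun_iff_map_prod_eq_prod_map_map (hX η hη).aemeasurable
        (hY η hη).aemeasurable).1 (hXY η hη), (hX η hη).map_eq, (hY η hη).map_eq,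
        gaussianReal_of_var_ne_zero _ hv, gaussianReal_of_var_ne_zero _ hw,
        prod_withDensity (measurable_gaussianPDF _ _) (measurable_gaussianPDF _ _)]
      congr 1
      funext z
      simp only [hp, gaussianPDF, add_sub_cancel_left]
      rw [ENNReal.ofReal_mul (gaussianPDFReal_nonneg _ _ _)]
    have haemeas : AEMeasurable (fun ω => (X ω, Y ω - X ω)) (P η) :=
      (hX η hη).aemeasurable.prodMk (hY η hη).aemeasurable
    have hcomp : (fun ω => (X ω, Y ω))
        = (fun z : ℝ × ℝ => (z.1, z.1 + z.2)) ∘ fun ω => (X ω, Y ω - X ω) := by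
      funext ω
      simp
    refine ⟨by rw [hcomp]; exact hshear.measurable.comp_aemeasurable haemeas, ?_⟩
    rw [hcomp, ← AEMeasurable.map_map_of_aemeasurable hshear.measurable.aemeasurable haemeas, hprod]
    ext s hs
    rw [Measure.map_apply hshear.measurable hs, withDensity_apply _ (hshear.measurable hs),
      withDensity_apply _ hs]
    exact hshear.setLIntegral_comp_preimage hs (hpmeas η).ennreal_ofReal
  · exact Filter.Eventually.of_forall fun ω =>
      (differentiableWithinAt_gaussianPDFReal hm.differentiableWithinAt).mul
        (differentiableWithinAt_gaussianPDFReal hn.differentiableWithinAt)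
  · simp only [hscore]
    exact (hLX.add hLY).integrable_sq
  · simp only [hscore]
    have hind : IndepFun (fun ω => m' / v * (X ω - m θ)) (fun ω => n' / w * (Y ω - X ω - n θ))
        (P θ) :=
      (hXY θ hθ).comp (φ := fun x => m' / v * (x - m θ)) (ψ := fun y => n' / w * (y - n θ))
        (by fun_prop) (by fun_prop)
    have h0 : ∫ ω, (m' / v * (X ω - m θ) + n' / w * (Y ω - X ω - n θ)) ∂(P θ) = 0 := by
      rw [integral_add (hLX.integrable one_le_two) (hLY.integrable one_le_two),
        integral_const_mul, integral_const_mul, hlawX.integral_gaussianReal,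
        hlawY.integral_gaussianReal]
      simp
    have hmeas : AEMeasurable
        (fun ω => m' / v * (X ω - m θ) + n' / w * (Y ω - X ω - n θ)) (P θ) :=
      (hLX.add hLY).aestronglyMeasurable.aemeasurable
    -- The score is centred, so its second moment is a variance, additive by independence.
    rw [← variance_of_integral_eq_zero hmeas h0, hind.variance_fun_add hLX hLY, variance_const_mul, variance_const_mul,
      hlawX.variance_gaussianReal, hlawY.variance_gaussianReal]
    field_simp

/-! ### Gaussian laws of the price statistics -/

/-- Integration by parts against `r - T`, the antiderivative of `1` that kills the boundary term at
`T`. As `G` is only integrable, its primitive is handled as an absolutely continuous function. -/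
theorem intervalIntegral_primitive_eq_integral_mul_sub {G : ℝ → ℝ} {T : ℝ}
    (hG : IntervalIntegrable G volume 0 T) :
    ∫ r in (0 : ℝ)..T, (∫ s in (0 : ℝ)..r, G s) = ∫ s in (0 : ℝ)..T, G s * (T - s) := by
  have hF := hG.absolutelyContinuousOnInterval_intervalIntegral Set.left_mem_uIcc
  have hg : AbsolutelyContinuousOnInterval (fun r : ℝ => r - T) 0 T :=
    ContDiffOn.absolutelyContinuousOnInterval (by fun_prop)
  have h := hF.integral_mul_deriv_eq_deriv_mul hg
  have hd : ∀ r : ℝ, deriv (fun r : ℝ => r - T) r = 1 := fun r => by simp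
  have hderiv : ∫ r in (0 : ℝ)..T, deriv (fun r => ∫ s in (0 : ℝ)..r, G s) r * (r - T)
      = ∫ r in (0 : ℝ)..T, G r * (r - T) := by
    apply intervalIntegral.integral_congr_ae
    filter_upwards [hG.ae_hasDerivAt_integral] with r hr hrT
    rw [(hr (Set.uIoc_subset_uIcc hrT) 0 Set.left_mem_uIcc).deriv]
  simp only [hd, mul_one, sub_self, mul_zero, intervalIntegral.integral_same, zero_mul,
    zero_sub] at h
  rw [h, hderiv, ← intervalIntegral.integral_neg]
  congr 1
  funext r
  ring

namespace IsPropagatorPrice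

variable {Ω : Type*} [MeasurableSpace Ω] {P : Measure Ω} {S₀ c σ T : ℝ} {G : ℝ → ℝ}
  {S : ℝ → Ω → ℝ}

theorem exists_brownian (hS : IsPropagatorPrice P S₀ c σ T G S) :
    ∃ W : ℝ≥0 → Ω → ℝ, IsBrownianReal W P ∧ ∀ᵐ ω ∂P, ∀ r : ℝ, 0 ≤ r → r ≤ T →
      S r ω = S₀ + c * (∫ s in (0 : ℝ)..r, G s) + σ * W r.toNNReal ω := by
  obtain ⟨W, hW, h⟩ := hS
  refine ⟨W, hW, ?_⟩
  filter_upwards [h] with ω hω r hr hrT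
  have := hω r.toNNReal (by rwa [Real.coe_toNNReal _ hr])
  rw [Real.coe_toNNReal _ hr] at this
  rw [this, intervalIntegral.integral_const_mul, intervalIntegral.integral_comp_sub_left]
  simp

theorem hasLaw_price (hS : IsPropagatorPrice P S₀ c σ T G S) {t : ℝ} (ht : 0 ≤ t) (htT : t ≤ T) :
    HasLaw (S t) (gaussianReal (S₀ + c * ∫ s in (0 : ℝ)..t, G s) (σ ^ 2 * t).toNNReal) P := by
  obtain ⟨W, hW, h⟩ := hS.exists_brownian
  have hlaw := gaussianReal_const_add (gaussianReal_const_mul (hW.hasLaw_eval t.toNNReal) σ)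
    (S₀ + c * ∫ s in (0 : ℝ)..t, G s)
  convert hlaw.congr (Y := S t) ?_ using 2
  · simp
  · rw [Real.toNNReal_mul (sq_nonneg σ)]
    congr 1
    exact Real.toNNReal_of_nonneg _
  · filter_upwards [h] with ω hω using hω t ht htT

theorem hasLaw_price_sub (hS : IsPropagatorPrice P S₀ c σ T G S)
    (hG : IntervalIntegrable G volume 0 T) {t : ℝ} (ht : 0 ≤ t) (htT : t ≤ T) :
    HasLaw (fun ω => S T ω - S t ω)
      (gaussianReal (c * ∫ s in t..T, G s) (σ ^ 2 * (T - t)).toNNReal) P := by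
  obtain ⟨W, hW, h⟩ := hS.exists_brownian
  have hlaw := gaussianReal_const_add
    (gaussianReal_const_mul (hW.hasLaw_sub T.toNNReal t.toNNReal) σ) (c * ∫ s in t..T, G s)
  have hT : 0 ≤ T := ht.trans htT
  have hmem : t ∈ Set.uIcc 0 T := by rw [Set.uIcc_of_le hT]; exact ⟨ht, htT⟩
  have hadd : (∫ s in (0 : ℝ)..t, G s) + ∫ s in t..T, G s = ∫ s in (0 : ℝ)..T, G s :=
    intervalIntegral.integral_add_adjacent_intervals
      (hG.mono_set (Set.uIcc_subset_uIcc Set.left_mem_uIcc hmem))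
      (hG.mono_set (Set.uIcc_subset_uIcc hmem Set.right_mem_uIcc))
  convert hlaw.congr (Y := fun ω => S T ω - S t ω) ?_ using 2
  · simp
  · rw [Real.toNNReal_mul (sq_nonneg σ)]
    congr 1
    · exact Real.toNNReal_of_nonneg _
    · ext
      simp only [coe_nndist, NNReal.val_eq_coe, Real.dist_eq, Real.coe_toNNReal _ hT,
        Real.coe_toNNReal _ ht, Real.coe_toNNReal _ (sub_nonneg.2 htT),
        abs_of_nonneg (sub_nonneg.2 htT)]
  · filter_upwards [h] with ω hω
    simp only [Pi.sub_apply]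
    rw [hω t ht htT, hω T hT le_rfl, ← hadd]
    ring

theorem indepFun_price_sub (hS : IsPropagatorPrice P S₀ c σ T G S) {t : ℝ} (ht : 0 ≤ t)
    (htT : t ≤ T) : IndepFun (S t) (fun ω => S T ω - S t ω) P := by
  obtain ⟨W, hW, h⟩ := hS.exists_brownian
  have hT : 0 ≤ T := ht.trans htT
  -- Since `W 0 = 0` almost surely, `W t` is itself an increment; the price statistics are affine
  -- images of it and of `W T - W t`.
  have hind := hW.hasIndepIncrements.indepFun_eval_sub (zero_le (a := t.toNNReal))
    (Real.toNNReal_le_toNNReal htT) hW.eval_zero_ae_eq_zero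
  refine (hind.comp (φ := fun x => S₀ + c * (∫ s in (0 : ℝ)..t, G s) + σ * x)
    (ψ := fun x => c * (∫ s in (0 : ℝ)..T, G s) - c * (∫ s in (0 : ℝ)..t, G s) + σ * x)
    (by fun_prop) (by fun_prop)).congr ?_ ?_
  · filter_upwards [h] with ω hω
    simp [hω t ht htT]
  · filter_upwards [h] with ω hω
    simp only [Function.comp_apply, Pi.sub_apply]
    rw [hω t ht htT, hω T hT le_rfl]
    ring

theorem hasLaw_vwapCost (hS : IsPropagatorPrice P S₀ c σ T G S)
    (hG : IntervalIntegrable G volume 0 T) (hT : 0 < T) :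
    HasLaw (vwapCost S T) (gaussianReal (S₀ * T + c * ∫ s in (0 : ℝ)..T, G s * (T - s))
      (σ ^ 2 * (T ^ 3 / 3)).toNNReal) P := by
  obtain ⟨W, hW, h⟩ := hS.exists_brownian
  have hlaw := gaussianReal_const_add (gaussianReal_const_mul (hW.hasLaw_intervalIntegral hT) σ)
    (S₀ * T + c * ∫ s in (0 : ℝ)..T, G s * (T - s))
  convert hlaw.congr (Y := vwapCost S T) ?_ using 2
  · simp
  · rw [Real.toNNReal_mul (sq_nonneg σ)]
    congr 1
    exact Real.toNNReal_of_nonneg _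
  · filter_upwards [h, hW.cont] with ω hω hc
    have hWint : IntervalIntegrable (fun r : ℝ => σ * W r.toNNReal ω) volume 0 T :=
      ((hc.comp continuous_real_toNNReal).const_mul σ).intervalIntegrable _ _
    have hGint : IntervalIntegrable (fun r => c * ∫ s in (0 : ℝ)..r, G s) volume 0 T :=
      ((intervalIntegral.continuousOn_primitive_interval' hG
        Set.left_mem_uIcc).const_mul c).intervalIntegrable
    have hSr : ∫ r in (0 : ℝ)..T, S r ω
        = ∫ r in (0 : ℝ)..T, (S₀ + c * (∫ s in (0 : ℝ)..r, G s) + σ * W r.toNNReal ω) := by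
      refine intervalIntegral.integral_congr fun r hr => ?_
      rw [Set.uIcc_of_le hT.le] at hr
      exact hω r hr.1 hr.2
    rw [vwapCost, hSr, intervalIntegral.integral_add (intervalIntegrable_const.add hGint) hWint,
      intervalIntegral.integral_add intervalIntegrable_const hGint, intervalIntegral.integral_const,
      intervalIntegral.integral_const_mul, intervalIntegral.integral_const_mul,
      intervalIntegral_primitive_eq_integral_mul_sub hG]
    simp [mul_comm]

end IsPropagatorPrice

/-- `S` is the price, `f v η` the impact function at the fixed trading rate `v`, `G` the decay
kernel; the derivative of `f v` at `θ` is taken relative to the parameter set `Γ`. -/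
theorem corollary2 {Ω : Type*} [MeasurableSpace Ω]
    (Γ : Set ℝ) (P : ℝ → Measure Ω) (S : ℝ → Ω → ℝ)
    (f : ℝ → ℝ → ℝ) (G : ℝ → ℝ) (S₀ σ v T t θ : ℝ)
    (hσ : 0 < σ) (ht : 0 < t) (htT : t < T)
    (hG : IntervalIntegrable G volume 0 T)
    (hS : ∀ η ∈ Γ, IsPropagatorPrice (P η) S₀ (f v η) σ T G S)
    (hθ : θ ∈ Γ) (hacc : AccPt θ (Filter.principal Γ))
    (hf : DifferentiableWithinAt ℝ (f v) Γ θ) :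
    HasFisherInfo Γ P (twoPrices S t T) θ (fisherInfo Γ P (twoPrices S t T) θ) ∧
    HasFisherInfo Γ P (vwapCost S T) θ (fisherInfo Γ P (vwapCost S T) θ) ∧
    fisherInfo Γ P (twoPrices S t T) θ =
      derivWithin (f v) Γ θ ^ 2 / σ ^ 2 * twoPriceFactor G t T ∧
    (twoPriceFactor G t T ≥ 3 / T ^ 3 * (∫ s in (0 : ℝ)..T, G s * (T - s)) ^ 2 →
      fisherInfo Γ P (twoPrices S t T) θ ≥ fisherInfo Γ P (vwapCost S T) θ) ∧
    (derivWithin (f v) Γ θ ≠ 0 →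
      (fisherInfo Γ P (twoPrices S t T) θ ≥ fisherInfo Γ P (vwapCost S T) θ ↔
        twoPriceFactor G t T ≥ 3 / T ^ 3 * (∫ s in (0 : ℝ)..T, G s * (T - s)) ^ 2)) := by
  have hT : 0 < T := ht.trans htT
  have htT' : 0 < T - t := sub_pos.2 htT
  set d := derivWithin (f v) Γ θ with hd
  set K := ∫ s in (0 : ℝ)..T, G s * (T - s) with hK
  have hfd : HasDerivWithinAt (f v) d Γ θ := hf.hasDerivWithinAt
  have hpair : HasFisherInfo Γ P (twoPrices S t T) θ (d ^ 2 / σ ^ 2 * twoPriceFactor G t T) := by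
    have h := hasFisherInfo_prodMk_of_indepFun_sub (X := S t) (Y := S T)
      (Real.toNNReal_pos.2 (by positivity : 0 < σ ^ 2 * t)).ne'
      (Real.toNNReal_pos.2 (by positivity : 0 < σ ^ 2 * (T - t))).ne'
      (fun η hη => (hS η hη).hasLaw_price ht.le htT.le)
      (fun η hη => (hS η hη).hasLaw_price_sub hG ht.le htT.le)
      (fun η hη => (hS η hη).indepFun_price_sub ht.le htT.le) hθ hacc
      ((hfd.mul_const _).const_add _) (hfd.mul_const _)
    rw [Real.coe_toNNReal _ (by positivity), Real.coe_toNNReal _ (by positivity)] at h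
    have e : d ^ 2 / σ ^ 2 * twoPriceFactor G t T = (d * ∫ s in (0 : ℝ)..t, G s) ^ 2 / (σ ^ 2 * t)
        + (d * ∫ s in t..T, G s) ^ 2 / (σ ^ 2 * (T - t)) := by
      rw [twoPriceFactor]
      field_simp
    rw [e]
    exact h
  have hcost : HasFisherInfo Γ P (vwapCost S T) θ (d ^ 2 / σ ^ 2 * (3 / T ^ 3 * K ^ 2)) := by
    have h := hasFisherInfo_gaussianReal
      (Real.toNNReal_pos.2 (by positivity : 0 < σ ^ 2 * (T ^ 3 / 3))).ne'
      (fun η hη => (hS η hη).hasLaw_vwapCost hG hT) hθ hacc ((hfd.mul_const K).const_add _)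
    rw [Real.coe_toNNReal _ (by positivity)] at h
    convert h using 1
    field_simp
  rw [hpair.fisherInfo_eq hθ hacc, hcost.fisherInfo_eq hθ hacc]
  -- Multiplying by `d² / σ² ≥ 0` preserves the inequality; cancelling it needs `d ≠ 0`.
  refine ⟨hpair, hcost, rfl, fun h => mul_le_mul_of_nonneg_left h (by positivity), fun hd0 => ?_⟩
  exact mul_le_mul_iff_right₀ (by positivity)
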